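/- Let $K$ be a field, $d\ge 1$ an integer, and $\ell=(\ell_1,\dots,\ell_n)\in\mathbb{N}^n$ a finite sequence of nonnegative integers. For a monomial $u$ let $\max(u)$ be the largest $i$ such that $x_i$ divides $u$, and for a monomial ideal $I$ let $G(I)$ be its set of minimal monomial generators. The following three conditions are equivalent. (a) There is a nonzero ideal $I\subset K[x_1,\dots,x_n]$ that is strongly stable (a monomial ideal such that, for every monomial $u$ and all $p<q$, $ux_q\in I$ implies $ux_p\in I$) and generated in degree $d$, with $|\{u\in G(I):\max(u)=k\}|=\ell_k$ for $k=1,\dots,n$. (b) There is a nonzero ideal $I\subset K[x_1,\dots,x_{n+d-1}]$ that is squarefree strongly stable (generated by squarefree monomials, and such that for every squarefree monomial $u\in I$ and all $p<q$ with $x_p\nmid u$ and $x_q\mid u$ one has $u(x_p/x_q)\in I$) and generated in degree $d$, with $|\{u\in G(I):\max(u)=k+d-1\}|=\ell_k$ for $k=1,\dots,n$. (c) $\ell$ is an $M$-vector with $\ell_2\le d$ (the latter condition is void if $n<2$). Here $\ell$ is an $M$-vector if $n\ge 1$ and, with $h_t=\ell_{t+1}$, one has $h_0=1$ and $h_{t+1}\le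 h_t^{\langle t\rangle}$ for $1\le t\le n-2$, where $0^{\langle t\rangle}=0$ and, for $a>0$ with $t$-th Macaulay representation $a=\binom{a(t)}{t}+\binom{a(t-1)}{t-1}+\cdots+\binom{a(j)}{j}$, $a(t)>a(t-1)>\cdots>a(j)\ge j\ge 1$, one sets $a^{\langle t\rangle}=\binom{a(t)+1}{t+1}+\binom{a(t-1)+1}{t}+\cdots+\binom{a(j)+1}{j+1}$. -/

import Mathlib

namespace MonomialIdeals

open MvPolynomial

/- A monomial `x^u` in the variables `x_1, …, x_m` is represented by its exponent vector
`u : Fin m →₀ ℕ`; the variable `x_i` (for `1 ≤ i ≤ m`) has the index `i - 1 : Fin m`.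
Divisibility of monomials is the pointwise order on exponent vectors. -/

/-- The set of monomials that lie in the ideal `I`. -/
def monomialsIn {K : Type*} [Field K] {m : ℕ} (I : Ideal (MvPolynomial (Fin m) K)) :
    Set (Fin m →₀ ℕ) :=
  {u | monomial u (1 : K) ∈ I}

/-- `I` is a monomial ideal: it is generated by monomials. -/
def IsMonomialIdeal {K : Type*} [Field K] {m : ℕ} (I : Ideal (MvPolynomial (Fin m) K)) : Prop :=
  ∃ V : Set (Fin m →₀ ℕ), I = Ideal.span ((fun u => monomial u (1 : K)) '' V)

/-- The set `G(I)` of minimal monomial generators of a monomial ideal `I`: the monomials in `I`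
that are minimal with respect to divisibility. -/
def minGens {K : Type*} [Field K] {m : ℕ} (I : Ideal (MvPolynomial (Fin m) K)) :
    Set (Fin m →₀ ℕ) :=
  {u | Minimal (fun v => v ∈ monomialsIn I) u}

/-- `I` is generated in degree `d`: it is generated by homogeneous polynomials of degree `d`. -/
def IsGeneratedInDegree {K : Type*} [Field K] {m : ℕ} (I : Ideal (MvPolynomial (Fin m) K))
    (d : ℕ) : Prop :=
  ∃ F : Set (MvPolynomial (Fin m) K), (∀ f ∈ F, f.IsHomogeneous d) ∧ I = Ideal.span F

/-- A set `V` of monomials is strongly stable if `u x_q ∈ V` and `p < q` imply `u x_p ∈ V`. -/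
def IsStronglyStableSet {m : ℕ} (V : Set (Fin m →₀ ℕ)) : Prop :=
  ∀ (u : Fin m →₀ ℕ) (p q : Fin m), p < q →
    u + Finsupp.single q 1 ∈ V → u + Finsupp.single p 1 ∈ V

/-- A strongly stable ideal. -/
def IsStronglyStable {K : Type*} [Field K] {m : ℕ} (I : Ideal (MvPolynomial (Fin m) K)) : Prop :=
  IsMonomialIdeal I ∧ IsStronglyStableSet (monomialsIn I)

/-- The monomial `x^u` is squarefree. -/
def IsSquarefreeMonomial {m : ℕ} (u : Fin m →₀ ℕ) : Prop :=
  ∀ i, u i ≤ 1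

/-- `I` is a squarefree monomial ideal: it is generated by squarefree monomials. -/
def IsSquarefreeMonomialIdeal {K : Type*} [Field K] {m : ℕ}
    (I : Ideal (MvPolynomial (Fin m) K)) : Prop :=
  ∃ V : Set (Fin m →₀ ℕ), (∀ u ∈ V, IsSquarefreeMonomial u) ∧
    I = Ideal.span ((fun u => monomial u (1 : K)) '' V)

/-- A set `V` of squarefree monomials is squarefree strongly stable if `u (x_p / x_q) ∈ V` for all
`u ∈ V` and all `p < q` such that `x_p` does not divide `u` and `x_q` divides `u`. -/
def IsSquarefreeStronglyStableSet {m : ℕ} (V : Set (Fin m →₀ ℕ)) : Prop :=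
  ∀ u ∈ V, ∀ p q : Fin m, p < q → p ∉ u.support → q ∈ u.support →
    u - Finsupp.single q 1 + Finsupp.single p 1 ∈ V

/-- A squarefree strongly stable ideal: a squarefree monomial ideal whose set of squarefree
monomials is squarefree strongly stable. -/
def IsSquarefreeStronglyStable {K : Type*} [Field K] {m : ℕ}
    (I : Ideal (MvPolynomial (Fin m) K)) : Prop :=
  IsSquarefreeMonomialIdeal I ∧
    IsSquarefreeStronglyStableSet {u | u ∈ monomialsIn I ∧ IsSquarefreeMonomial u}

/-- `max(u)`: the largest `i ∈ {1, …, m}` such that `x_i` divides the monomial `u`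
(and `0` for `u = 1`). -/
def maxVar {m : ℕ} (u : Fin m →₀ ℕ) : ℕ :=
  u.support.sup (fun i => (i : ℕ) + 1)

/-- The `ℓ`-sequence `(ℓ_1(I), …, ℓ_n(I))`, where `ℓ_k(I)` is the number of `u ∈ G(I)` with
`max(u) = k`; the entry `ℓ_k(I)` has the index `k - 1 : Fin n`. -/
noncomputable def ellSeq {K : Type*} [Field K] {n : ℕ} (I : Ideal (MvPolynomial (Fin n) K)) :
    Fin n → ℕ :=
  fun k => {u | u ∈ minGens I ∧ maxVar u = (k : ℕ) + 1}.ncard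

/-- The `ℓ*`-sequence `(ℓ*_1(I), …, ℓ*_n(I))` of an ideal `I` in `n + d - 1` variables, where
`ℓ*_k(I)` is the number of `u ∈ G(I)` with `max(u) = k + d - 1`; the entry `ℓ*_k(I)` has the
index `k - 1 : Fin n`. -/
noncomputable def ellStarSeq {K : Type*} [Field K] (n d : ℕ)
    (I : Ideal (MvPolynomial (Fin (n + d - 1)) K)) : Fin n → ℕ :=
  fun k => {u | u ∈ minGens I ∧ maxVar u = ((k : ℕ) + 1) + d - 1}.ncard

/-- `a = C(c t, t) + C(c (t-1), t-1) + ⋯ + C(c j, j)` with `c t > c (t-1) > ⋯ > c j ≥ j ≥ 1` is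
the `t`-th Macaulay representation of `a`. -/
def IsMacaulayRep (t a j : ℕ) (c : ℕ → ℕ) : Prop :=
  1 ≤ j ∧ j ≤ t ∧ j ≤ c j ∧ StrictMonoOn c (Set.Icc j t) ∧
    a = ∑ i ∈ Finset.Icc j t, (c i).choose i

/-- `b = a^⟨t⟩`: if `a > 0` has the `t`-th Macaulay representation
`a = C(c t, t) + ⋯ + C(c j, j)`, then `a^⟨t⟩ = C(c t + 1, t + 1) + ⋯ + C(c j + 1, j + 1)`;
moreover `0^⟨t⟩ = 0`. -/
def IsMacaulayUpper (t a b : ℕ) : Prop :=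
  (a = 0 ∧ b = 0) ∨
    ∃ (j : ℕ) (c : ℕ → ℕ), IsMacaulayRep t a j c ∧
      b = ∑ i ∈ Finset.Icc j t, (c i + 1).choose (i + 1)

/-- `h = (h_0, h_1, …, h_{n-1})`, `n ≥ 1`, is an `M`-vector: `h_0 = 1` and
`h_{t+1} ≤ (h_t)^⟨t⟩` for all `t ≥ 1` (with `t + 1 ≤ n - 1`). -/
def IsMVector {n : ℕ} (h : Fin n → ℕ) : Prop :=
  (∃ hn : 0 < n, h ⟨0, hn⟩ = 1) ∧
    ∀ (t : ℕ) (_ : 1 ≤ t) (ht : t + 1 < n),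
      ∃ b, IsMacaulayUpper t (h ⟨t, (Nat.lt_succ_self t).trans ht⟩) b ∧ h ⟨t + 1, ht⟩ ≤ b

end MonomialIdeals

/-!
A monomial of degree `d + 1` is a weakly increasing sequence `r : Fin (d + 1) →o Fin n` of indices
of variables, and a squarefree one becomes such a sequence after subtracting `i` from its `i`-th
entry. A set of monomials of either kind is strongly stable exactly if the corresponding set of
sequences is a lower set for the pointwise order. So both kinds of ideals amount to nonempty lower
sets `E` of `Fin (d + 1) →o Fin n`, and `ℓ_{k+1}` counts the `r ∈ E` with last entry `k`.

The other `d` entries of such an `r` form a partition in a `d × k` box. Its conjugate is a weakly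
increasing sequence of length `k` with entries at most `d`, that is, a monomial of degree `k` in
`d + 1` variables. The conjugates with `k = t` form a lower set, and dropping the smallest entry
sends those with `k = t + 1` to those with `k = t`. Hence `ℓ` is an `M`-vector by Macaulay's theorem
for lower sets, which is proved by Green's method: induct on the number of elements divisible by the
first variable. Conversely, for an `M`-vector `ℓ` the initial segments of size `ℓ_{k+1}` in the
colexicographic order are the layers of a lower set.

Macaulay representations are encoded by weakly increasing sequences: `c i + i` is the upper entry of
the binomial coefficient with lower entry `i + 1`. Then `a ↦ a^⟨t⟩` is the map
`cascade 1 c ↦ cascade 1 c + cascade 2 c`, and `cascade 1` is the rank in the colexicographic order.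
-/

namespace MonomialIdeals

open MvPolynomial

/-- Weakly increasing sequences of natural numbers of length `t`: the sequence `c` stands for the
monomial `∏ i, x_{c i}` of degree `t`, and also for the `t`-th Macaulay representation with the
strictly increasing entries `c i + i`. -/
abbrev MonoSeq (t : ℕ) := Fin t →o ℕ

namespace MonoSeq

variable {t : ℕ}

/-- The sequence without its smallest entry. -/
def tail (c : MonoSeq (t + 1)) : MonoSeq t := c.comp (Fin.succOrderEmb t).toOrderHom

/-- The sequence without its largest entry. -/
def init (c : MonoSeq (t + 1)) : MonoSeq t := c.comp Fin.castSuccOrderEmb.toOrderHom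

/-- The sequence `c` extended by an upper bound `N` of its entries. -/
def snoc (c : MonoSeq t) (N : ℕ) (h : ∀ i, c i ≤ N) : MonoSeq (t + 1) where
  toFun := Fin.snoc c N
  monotone' i j hij := by
    induction j using Fin.lastCases with
    | last => induction i using Fin.lastCases with
      | last => exact le_rfl
      | cast i => simpa using h i
    | cast j => induction i using Fin.lastCases with
      | last => exact absurd hij (Fin.castSucc_lt_last j).not_ge
      | cast i => simpa using c.monotone (Fin.castSucc_le_castSucc_iff.1 hij)

/-- The sequence `c` with a smallest entry `0` put in front. -/
def consZero (c : MonoSeq t) : MonoSeq (t + 1) where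
  toFun := Fin.cons 0 c
  monotone' i j hij := by
    induction i using Fin.cases with
    | zero => simp
    | succ i => induction j using Fin.cases with
      | zero => exact absurd hij (Fin.succ_pos i).not_ge
      | succ j => simpa using c.monotone (Fin.succ_le_succ_iff.1 hij)

/-- All entries raised by one. -/
def succ (c : MonoSeq t) : MonoSeq t where
  toFun i := c i + 1
  monotone' _ _ hij := Nat.succ_le_succ (c.monotone hij)

/-- All entries lowered by one, where entries `0` stay `0`. -/
def pred (c : MonoSeq t) : MonoSeq t where
  toFun i := c i - 1
  monotone' _ _ hij := Nat.sub_le_sub_right (c.monotone hij) 1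

@[simp] lemma tail_apply (c : MonoSeq (t + 1)) (i : Fin t) : c.tail i = c i.succ := rfl

@[simp] lemma init_apply (c : MonoSeq (t + 1)) (i : Fin t) : c.init i = c i.castSucc := rfl

@[simp] lemma snoc_last (c : MonoSeq t) (N : ℕ) (h : ∀ i, c i ≤ N) :
    c.snoc N h (Fin.last t) = N :=
  Fin.snoc_last (α := fun _ => ℕ) N c

@[simp] lemma snoc_castSucc (c : MonoSeq t) (N : ℕ) (h : ∀ i, c i ≤ N) (i : Fin t) :
    c.snoc N h i.castSucc = c i :=
  Fin.snoc_castSucc (α := fun _ => ℕ) N c i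

@[simp] lemma init_snoc (c : MonoSeq t) (N : ℕ) (h : ∀ i, c i ≤ N) : (c.snoc N h).init = c := by
  ext i
  simp

@[simp] lemma tail_consZero (c : MonoSeq t) : c.consZero.tail = c := rfl

lemma consZero_tail {c : MonoSeq (t + 1)} (h : c 0 = 0) : c.tail.consZero = c := by
  ext i
  induction i using Fin.cases with
  | zero => exact h.symm
  | succ i => rfl

lemma consZero_mono : Monotone (consZero (t := t)) := fun c c' h i => by
  induction i using Fin.cases with
  | zero => exact le_rfl
  | succ i => exact h i

lemma consZero_injective : Function.Injective (consZero (t := t)) :=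
  Function.LeftInverse.injective tail_consZero

@[simp] lemma succ_apply (c : MonoSeq t) (i : Fin t) : c.succ i = c i + 1 := rfl

@[simp] lemma pred_apply (c : MonoSeq t) (i : Fin t) : c.pred i = c i - 1 := rfl

lemma succ_mono : Monotone (succ (t := t)) := fun _ _ h i => Nat.succ_le_succ (h i)

lemma succ_injective : Function.Injective (succ (t := t)) := fun c c' h => by
  ext i
  simpa using DFunLike.congr_fun h i

lemma succ_pred {c : MonoSeq (t + 1)} (h : 0 < c 0) : c.pred.succ = c := by
  ext i
  have : c 0 ≤ c i := c.monotone (Fin.zero_le i)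
  simp only [succ_apply, pred_apply]
  omega

lemma eq_of_init_eq_of_last_eq {c c' : MonoSeq (t + 1)} (h : c.init = c'.init)
    (hlast : c (Fin.last t) = c' (Fin.last t)) : c = c' := by
  ext i
  induction i using Fin.lastCases with
  | last => exact hlast
  | cast i => exact DFunLike.congr_fun h i

/-- The sum `∑ i, C(c i + i, i + k)`. For `k = 1` it is the number with the Macaulay representation
given by `c`, which is also the rank of `c` in the colexicographic order. -/
def cascade (k : ℕ) (c : MonoSeq t) : ℕ := ∑ i : Fin t, (c i + i).choose (i + k)

lemma cascade_eq_zero (k : ℕ) (c : MonoSeq 0) : cascade k c = 0 := rfl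

lemma cascade_one_eq_apply_zero (c : MonoSeq 1) : cascade 1 c = c 0 := by
  simp [cascade]

lemma cascade_eq_init_add (k : ℕ) (c : MonoSeq (t + 1)) :
    cascade k c = cascade k c.init + (c (Fin.last t) + t).choose (t + k) := by
  simp [cascade, Fin.sum_univ_castSucc]

lemma cascade_mono (k : ℕ) : Monotone (cascade k (t := t)) := fun _ _ h =>
  Finset.sum_le_sum fun i _ => Nat.choose_le_choose _ (Nat.add_le_add_right (h i) _)

lemma cascade_succ_add_choose_le (k : ℕ) {c : MonoSeq t} {N : ℕ} (h : ∀ i, c i ≤ N) :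
    cascade (k + 1) c + N.choose k ≤ (N + t).choose (t + k) := by
  induction t with
  | zero => simp [cascade_eq_zero]
  | succ t ih =>
    have hlast : (c (Fin.last t) + t).choose (t + k + 1) ≤ (N + t).choose (t + k + 1) :=
      Nat.choose_le_choose _ (Nat.add_le_add_right (h _) _)
    calc
      cascade (k + 1) c + N.choose k
        = (cascade (k + 1) c.init + N.choose k)
            + (c (Fin.last t) + t).choose (t + k + 1) := by
          rw [cascade_eq_init_add, ← add_assoc t]
          ring
      _ ≤ (N + t).choose (t + k) + (N + t).choose (t + k + 1) :=
          Nat.add_le_add (ih fun i => h _) hlast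
      _ = (N + (t + 1)).choose (t + 1 + k) := by
          rw [← Nat.choose_succ_succ, Nat.succ_eq_add_one, Nat.succ_eq_add_one]
          congr 1
          omega

lemma cascade_one_lt {c : MonoSeq t} {N : ℕ} (h : ∀ i, c i ≤ N) :
    cascade 1 c < (N + t).choose t := by
  have := cascade_succ_add_choose_le 0 h
  rwa [Nat.choose_zero_right] at this

lemma cascade_two_le {c : MonoSeq t} {N : ℕ} (h : ∀ i, c i ≤ N) :
    cascade 2 c ≤ (N + t).choose (t + 1) :=
  (Nat.le_add_right _ _).trans (cascade_succ_add_choose_le 1 h)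

lemma cascade_one_lt_of_last_lt {c c' : MonoSeq (t + 1)}
    (h : c (Fin.last t) < c' (Fin.last t)) : cascade 1 c < cascade 1 c' :=
  calc cascade 1 c < (c (Fin.last t) + (t + 1)).choose (t + 1) :=
        cascade_one_lt fun i => c.monotone (Fin.le_last i)
    _ ≤ (c' (Fin.last t) + t).choose (t + 1) := Nat.choose_le_choose _ (by omega)
    _ ≤ cascade 1 c' := (cascade_eq_init_add 1 c').ge.trans' (Nat.le_add_left _ _)

lemma cascade_two_le_of_cascade_one_le {c c' : MonoSeq t} (h : cascade 1 c ≤ cascade 1 c') :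
    cascade 2 c ≤ cascade 2 c' := by
  induction t with
  | zero => rfl
  | succ t ih =>
    rcases lt_trichotomy (c (Fin.last t)) (c' (Fin.last t)) with hlt | heq | hgt
    · calc cascade 2 c ≤ (c (Fin.last t) + (t + 1)).choose (t + 2) :=
            cascade_two_le fun i => c.monotone (Fin.le_last i)
        _ ≤ (c' (Fin.last t) + t).choose (t + 2) := Nat.choose_le_choose _ (by omega)
        _ ≤ cascade 2 c' := (cascade_eq_init_add 2 c').ge.trans' (Nat.le_add_left _ _)
    · simp only [cascade_eq_init_add, heq, add_le_add_iff_right] at h ⊢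
      exact ih h
    · exact absurd h (cascade_one_lt_of_last_lt hgt).not_ge

lemma cascade_one_injective : Function.Injective (cascade 1 (t := t)) := by
  induction t with
  | zero => exact fun c c' _ => DFunLike.ext c c' fun i => i.elim0
  | succ t ih =>
    intro c c' h
    have hlast : c (Fin.last t) = c' (Fin.last t) := by
      by_contra hne
      rcases Nat.lt_or_gt_of_ne hne with hlt | hgt
      · exact (cascade_one_lt_of_last_lt hlt).ne h
      · exact (cascade_one_lt_of_last_lt hgt).ne' h
    rw [cascade_eq_init_add, cascade_eq_init_add, hlast, Nat.add_right_cancel_iff] at h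
    exact eq_of_init_eq_of_last_eq (ih h) hlast

lemma exists_cascade_one_eq_of_lt :
    ∀ {t N a : ℕ}, a < (N + t).choose t → ∃ c : MonoSeq t, (∀ i, c i ≤ N) ∧ cascade 1 c = a
  | 0, N, a, h => ⟨⊥, fun i => i.elim0, by simp_all [cascade_eq_zero]⟩
  | t + 1, 0, a, h => ⟨⊥, fun _ => le_rfl, by simp_all [cascade]⟩
  | t + 1, N + 1, a, h => by
    rcases lt_or_ge a ((N + (t + 1)).choose (t + 1)) with hlt | hge
    · obtain ⟨c, hcN, hca⟩ := exists_cascade_one_eq_of_lt hlt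
      exact ⟨c, fun i => (hcN i).trans N.le_succ, hca⟩
    · have hN : N + 1 + t = N + (t + 1) := by omega
      have hsub : a - (N + (t + 1)).choose (t + 1) < (N + 1 + t).choose t := by
        rw [← add_assoc (N + 1), Nat.choose_succ_succ', hN] at h
        rw [hN]
        omega
      obtain ⟨c, hcN, hca⟩ := exists_cascade_one_eq_of_lt hsub
      refine ⟨c.snoc (N + 1) hcN, fun i => ?_, ?_⟩
      · simpa using (c.snoc (N + 1) hcN).monotone (Fin.le_last i)
      · rw [cascade_eq_init_add, init_snoc, snoc_last, hca, hN]
        omega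

lemma exists_cascade_one_eq (t a : ℕ) : ∃ c : MonoSeq (t + 1), cascade 1 c = a := by
  have h : a < (a + (t + 1)).choose (t + 1) :=
    calc a < (a + 1).choose a := by simp
      _ ≤ (a + (t + 1)).choose a := Nat.choose_le_choose _ (by omega)
      _ = (a + (t + 1)).choose (t + 1) := Nat.choose_symm_add
  obtain ⟨c, -, hc⟩ := exists_cascade_one_eq_of_lt h
  exact ⟨c, hc⟩

lemma ncard_setOf_cascade_one_lt {N : ℕ} (h : t = 0 → N = 1) :
    {c : MonoSeq t | cascade 1 c < N}.ncard = N := by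
  have himage : cascade 1 '' {c : MonoSeq t | cascade 1 c < N} = Set.Iio N := by
    refine Set.Subset.antisymm (Set.image_subset_iff.2 fun c hc => hc) fun a ha => ?_
    suffices ∃ c : MonoSeq t, cascade 1 c = a by
      obtain ⟨c, rfl⟩ := this
      exact ⟨c, ha, rfl⟩
    cases t with
    | zero => exact ⟨⊥, by simp_all [cascade_eq_zero]⟩
    | succ t => exact exists_cascade_one_eq t a
  rw [← Set.ncard_image_of_injective _ cascade_one_injective, himage]
  simp [Set.ncard_eq_toFinset_card']

lemma cascade_one_add_cascade_two (c : MonoSeq t) :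
    cascade 1 c + cascade 2 c = ∑ i : Fin t, (c i + i + 1).choose (i + 2) := by
  rw [cascade, cascade, ← Finset.sum_add_distrib]
  exact Finset.sum_congr rfl fun i _ => (Nat.choose_succ_succ _ _).symm

lemma cascade_pred_add_cascade_pred (c : MonoSeq t) :
    cascade 1 c.pred + cascade 2 c.pred = cascade 2 c := by
  rw [cascade_one_add_cascade_two, cascade]
  refine Finset.sum_congr rfl fun i _ => ?_
  rcases Nat.eq_zero_or_pos (c i) with h | h
  · simp [h, Nat.choose_eq_zero_of_lt]
  · rw [pred_apply, show c i - 1 + i + 1 = c i + i by omega]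

lemma cascade_two_tail_le (c : MonoSeq (t + 1)) : cascade 2 c.tail ≤ cascade 1 c.pred := by
  simp only [cascade, Fin.sum_univ_succ (n := t), Fin.val_succ, tail_apply, pred_apply]
  refine le_add_left (Finset.sum_le_sum fun i _ => ?_)
  rcases Nat.eq_zero_or_pos (c i.succ) with h | h
  · simp [h, Nat.choose_eq_zero_of_lt]
  · rw [show c i.succ - 1 + (i + 1) = c i.succ + i by omega]

lemma cascade_one_le_pred_add_tail (c : MonoSeq (t + 1)) :
    cascade 1 c ≤ cascade 1 c.pred + cascade 1 c.tail + 1 := by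
  have hsucc (i : Fin t) : (c i.succ + (i + 1)).choose (i + 1 + 1) =
      (c i.succ - 1 + (i + 1)).choose (i + 1 + 1) + (c i.succ + i).choose (i + 1) := by
    rcases Nat.eq_zero_or_pos (c i.succ) with h | h
    · simp [h]
    · rw [show c i.succ - 1 + (i + 1) = c i.succ + i by omega, ← add_assoc,
        Nat.choose_succ_succ, add_comm]
  simp only [cascade, Fin.sum_univ_succ, Fin.val_succ, hsucc, Finset.sum_add_distrib, tail_apply,
    pred_apply, Fin.val_zero, add_zero, zero_add, Nat.choose_one_right]
  omega

lemma cascade_tail_add_cascade_tail_le (c : MonoSeq (t + 1)) :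
    cascade 1 c.tail + cascade 2 c.tail ≤ cascade 1 c := by
  rw [cascade_one_add_cascade_two, cascade, Fin.sum_univ_succ]
  exact Nat.le_add_left _ _

open scoped Finset

lemma map_succ_preimage_succ (A : Finset (MonoSeq (t + 1))) :
    (A.preimage succ succ_injective.injOn).map ⟨succ, succ_injective⟩ = {v ∈ A | 0 < v 0} := by
  ext v
  simp only [Finset.mem_map, Finset.mem_preimage, Function.Embedding.coeFn_mk, Finset.mem_filter]
  constructor
  · rintro ⟨w, hw, rfl⟩
    exact ⟨hw, Nat.succ_pos _⟩
  · rintro ⟨hv, hpos⟩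
    exact ⟨v.pred, (succ_pred hpos).symm ▸ hv, succ_pred hpos⟩

lemma map_consZero_preimage_consZero (A : Finset (MonoSeq (t + 1))) :
    (A.preimage consZero consZero_injective.injOn).map ⟨consZero, consZero_injective⟩ =
      {v ∈ A | ¬0 < v 0} := by
  ext v
  simp only [Finset.mem_map, Finset.mem_preimage, Function.Embedding.coeFn_mk, Finset.mem_filter,
    Nat.pos_iff_ne_zero, not_not]
  constructor
  · rintro ⟨w, hw, rfl⟩
    exact ⟨hw, rfl⟩
  · rintro ⟨hv, hzero⟩
    exact ⟨v.tail, (consZero_tail hzero).symm ▸ hv, consZero_tail hzero⟩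

lemma card_preimage_succ (A : Finset (MonoSeq (t + 1))) :
    #(A.preimage succ succ_injective.injOn) = #{v ∈ A | 0 < v 0} := by
  rw [← map_succ_preimage_succ, Finset.card_map]

lemma card_preimage_consZero (A : Finset (MonoSeq (t + 1))) :
    #(A.preimage consZero consZero_injective.injOn) = #{v ∈ A | ¬0 < v 0} := by
  rw [← map_consZero_preimage_consZero, Finset.card_map]

lemma sum_head_eq_card_add_sum_preimage_succ (A : Finset (MonoSeq (t + 1))) :
    ∑ v ∈ A, v 0 = #(A.preimage succ succ_injective.injOn)
      + ∑ v ∈ A.preimage succ succ_injective.injOn, v 0 := by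
  have hfilter : ∑ v ∈ A, v 0 = ∑ v ∈ A with 0 < v 0, v 0 :=
    (Finset.sum_filter_of_ne fun v _ h => Nat.pos_of_ne_zero h).symm
  rw [hfilter, ← map_succ_preimage_succ, Finset.sum_map, Finset.card_eq_sum_ones,
    ← Finset.sum_add_distrib]
  exact Finset.sum_congr rfl fun v _ => Nat.add_comm _ _

lemma card_filter_head_pos_lt {A : Finset (MonoSeq (t + 1))}
    (hA : IsLowerSet (A : Set (MonoSeq (t + 1)))) (hne : A.Nonempty) :
    #{v ∈ A | 0 < v 0} < #A := by
  obtain ⟨v, hv⟩ := hne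
  exact Finset.card_lt_card (Finset.filter_ssubset.2 ⟨⊥, hA bot_le hv, lt_irrefl 0⟩)

lemma card_le_sum_of_tail_mem {k : ℕ} {A : Finset (MonoSeq (t + 1))}
    {B : Finset (MonoSeq (t + 2))} (hB : ∀ v ∈ B, k ≤ v 0 ∧ v.tail ∈ A) :
    #B ≤ ∑ w ∈ A, (w 0 + 1 - k) := by
  classical
  have hhead (w : MonoSeq (t + 1)) : #{v ∈ B | v.tail = w} ≤ #(Finset.Icc k (w 0)) := by
    refine Finset.card_le_card_of_injOn (fun v => v 0) (fun v hv => ?_) fun v hv v' hv' h => ?_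
    · obtain ⟨hvB, rfl⟩ := Finset.mem_filter.1 hv
      exact Finset.mem_coe.2 (Finset.mem_Icc.2 ⟨(hB v hvB).1, v.monotone (Fin.zero_le _)⟩)
    · have htail : v.tail = v'.tail :=
        (Finset.mem_filter.1 hv).2.trans (Finset.mem_filter.1 hv').2.symm
      exact DFunLike.ext _ _ (Fin.cases h (DFunLike.congr_fun htail))
  calc #B = ∑ w ∈ A, #{v ∈ B | v.tail = w} :=
        Finset.card_eq_sum_card_fiberwise fun v hv => (hB v hv).2
    _ ≤ ∑ w ∈ A, (w 0 + 1 - k) :=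
        Finset.sum_le_sum fun w _ => (hhead w).trans_eq (Nat.card_Icc _ _)

lemma sum_head_le_of_card_filter_head_pos_le
    (green : ∀ (A : Finset (MonoSeq (t + 1))) (c : MonoSeq (t + 1)),
      IsLowerSet (A : Set (MonoSeq (t + 1))) → #A ≤ cascade 1 c →
        #{v ∈ A | 0 < v 0} ≤ cascade 1 c.pred)
    (A : Finset (MonoSeq (t + 1))) (c : MonoSeq (t + 1))
    (hA : IsLowerSet (A : Set (MonoSeq (t + 1)))) (h : #A ≤ cascade 1 c) :
    ∑ v ∈ A, v 0 ≤ cascade 2 c := by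
  induction hn : #A using Nat.strong_induction_on generalizing A c with
  | _ n ih =>
    subst hn
    rcases A.eq_empty_or_nonempty with rfl | hne
    · simp
    set B := A.preimage succ succ_injective.injOn with hB
    have hB_card : #B = #{v ∈ A | 0 < v 0} := card_preimage_succ A
    have hB_lower : IsLowerSet (B : Set (MonoSeq (t + 1))) := by
      simpa [hB] using hA.preimage succ_mono
    have hB_le : #B ≤ cascade 1 c.pred := hB_card.trans_le (green A c hA h)
    calc ∑ v ∈ A, v 0 = #B + ∑ v ∈ B, v 0 := sum_head_eq_card_add_sum_preimage_succ A
      _ ≤ cascade 1 c.pred + cascade 2 c.pred := Nat.add_le_add hB_le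
          (ih _ (hB_card.trans_lt (card_filter_head_pos_lt hA hne)) B c.pred hB_lower hB_le rfl)
      _ = cascade 2 c := cascade_pred_add_cascade_pred c

/-- Green's hyperplane restriction theorem for lower sets: `A` consists of the standard monomials of
degree `t + 1`, and the `v ∈ A` with `0 < v 0` are those that survive setting `x_0 = 0`. -/
theorem card_filter_head_pos_le (A : Finset (MonoSeq (t + 1))) (c : MonoSeq (t + 1))
    (hA : IsLowerSet (A : Set (MonoSeq (t + 1)))) (h : #A ≤ cascade 1 c) :
    #{v ∈ A | 0 < v 0} ≤ cascade 1 c.pred := by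
  induction t with
  | zero =>
    rcases A.eq_empty_or_nonempty with rfl | hne
    · simp
    have hlt := card_filter_head_pos_lt hA hne
    rw [cascade_one_eq_apply_zero] at h ⊢
    rw [pred_apply]
    omega
  | succ t ih =>
    set B := A.preimage consZero consZero_injective.injOn with hB
    have hB_lower : IsLowerSet (B : Set (MonoSeq (t + 1))) := by
      simpa [hB] using hA.preimage consZero_mono
    have hsplit : #{v ∈ A | 0 < v 0} + #B = #A := by
      rw [card_preimage_consZero, Finset.card_filter_add_card_filter_not]
    have htail : ∀ v ∈ ({v ∈ A | 0 < v 0} : Finset _), 1 ≤ v 0 ∧ v.tail ∈ B := by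
      intro v hv
      obtain ⟨hv, hpos⟩ := Finset.mem_filter.1 hv
      refine ⟨hpos, Finset.mem_preimage.2 (hA (fun i => ?_) hv)⟩
      exact Fin.cases (Nat.zero_le _) (fun _ => le_rfl) i
    -- If the bound failed, `B` would be so small that its sum of heads, which bounds the
    -- left-hand side, is at most `cascade 1 c.pred` after all.
    by_contra! hcontra
    have hB_le : #B ≤ cascade 1 c.tail := by
      have := cascade_one_le_pred_add_tail c
      omega
    refine hcontra.not_ge ?_
    calc #{v ∈ A | 0 < v 0} ≤ ∑ w ∈ B, (w 0 + 1 - 1) := card_le_sum_of_tail_mem htail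
      _ = ∑ w ∈ B, w 0 := rfl
      _ ≤ cascade 2 c.tail := sum_head_le_of_card_filter_head_pos_le ih B c.tail hB_lower hB_le
      _ ≤ cascade 1 c.pred := cascade_two_tail_le c

/-- Macaulay's theorem for lower sets. -/
theorem card_le_cascade_add_cascade {A : Finset (MonoSeq (t + 1))} {B : Finset (MonoSeq (t + 2))}
    {c : MonoSeq (t + 1)} (hA : IsLowerSet (A : Set (MonoSeq (t + 1)))) (h : #A ≤ cascade 1 c)
    (hB : ∀ v ∈ B, v.tail ∈ A) : #B ≤ cascade 1 c + cascade 2 c := by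
  calc #B ≤ ∑ w ∈ A, (w 0 + 1) :=
        card_le_sum_of_tail_mem (k := 0) fun v hv => ⟨Nat.zero_le _, hB v hv⟩
    _ = #A + ∑ w ∈ A, w 0 := by
        rw [Finset.sum_add_distrib, Finset.sum_const, smul_eq_mul, mul_one, add_comm]
    _ ≤ cascade 1 c + cascade 2 c := Nat.add_le_add h
        (sum_head_le_of_card_filter_head_pos_le card_filter_head_pos_le A c hA h)

end MonoSeq

section MacaulayRep

open MonoSeq

variable {t j : ℕ} {e : ℕ → ℕ}

lemma sum_Icc_eq_sum_fin (hj : 1 ≤ j) {c : MonoSeq t}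
    (hzero : ∀ i : Fin t, (i : ℕ) + 1 < j → c i = 0)
    (he : ∀ i : Fin t, j ≤ i + 1 → e (i + 1) = c i + i) (f : ℕ → ℕ → ℕ)
    (hf : ∀ i, f (i + 1) i = 0) :
    ∑ i ∈ Finset.Icc j t, f i (e i) = ∑ i : Fin t, f (i + 1) (c i + i) := by
  have hIcc : Finset.Icc j t = {i ∈ Finset.Ico (0 + 1) (t + 1) | j ≤ i} := by
    ext i
    simp only [Finset.mem_Icc, Finset.mem_filter, Finset.mem_Ico]
    omega
  rw [hIcc, Finset.sum_filter, ← Finset.sum_Ico_add', ← Finset.range_eq_Ico, Finset.sum_range]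
  refine Finset.sum_congr rfl fun i _ => ?_
  split_ifs with h
  · rw [he i h]
  · rw [hzero i (not_le.1 h), zero_add, hf]

lemma IsMacaulayRep.le_apply {a i : ℕ} (h : IsMacaulayRep t a j e) (hji : j ≤ i) (hit : i ≤ t) :
    i ≤ e i := by
  obtain ⟨-, -, hje, hmono, -⟩ := h
  induction i, hji using Nat.le_induction with
  | base => exact hje
  | succ i hji ih =>
    have hlt : e i < e (i + 1) := hmono ⟨hji, by omega⟩ ⟨by omega, hit⟩ i.lt_succ_self
    have := ih (by omega)
    omega

lemma IsMacaulayRep.exists_monoSeq {a : ℕ} (h : IsMacaulayRep t a j e) :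
    ∃ c : MonoSeq t, (∀ i : Fin t, (i : ℕ) + 1 < j → c i = 0) ∧
      ∀ i : Fin t, j ≤ i + 1 → e (i + 1) = c i + i := by
  have hle {i : ℕ} (hji : j ≤ i) (hit : i ≤ t) : i ≤ e i := h.le_apply hji hit
  obtain ⟨hj, hjt, -, hmono, -⟩ := h
  obtain ⟨s, rfl⟩ : ∃ s, t = s + 1 := ⟨t - 1, by omega⟩
  refine ⟨⟨fun i => if j ≤ i + 1 then e (i + 1) - i else 0, Fin.monotone_iff_le_succ.2 ?_⟩,
    fun i hi => if_neg hi.not_ge, fun i hi => ?_⟩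
  · intro i
    change (if j ≤ (i : ℕ) + 1 then e (i + 1) - i else 0) ≤
      if j ≤ (i : ℕ) + 1 + 1 then e (i + 1 + 1) - (i + 1) else 0
    split_ifs with hi hi'
    · have : e (i + 1) < e (i + 1 + 1) :=
        hmono ⟨hi, by omega⟩ ⟨hi', by omega⟩ (Nat.lt_succ_self _)
      omega
    · omega
    · exact Nat.zero_le _
    · exact le_rfl
  · have := hle hi i.is_lt
    rw [OrderHom.coe_mk, if_pos hi]
    omega

lemma IsMacaulayUpper.exists_monoSeq {a b : ℕ} (h : IsMacaulayUpper t a b) :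
    ∃ c : MonoSeq t, cascade 1 c = a ∧ cascade 1 c + cascade 2 c = b := by
  rcases h with ⟨rfl, rfl⟩ | ⟨j, e, hrep, rfl⟩
  · exact ⟨⊥, by simp [cascade], by simp [cascade, Nat.choose_eq_zero_of_lt]⟩
  obtain ⟨c, hzero, he⟩ := hrep.exists_monoSeq
  obtain ⟨hj, -, -, -, rfl⟩ := hrep
  refine ⟨c, ?_, ?_⟩
  · exact (sum_Icc_eq_sum_fin hj hzero he (fun i x => x.choose i) (by simp)).symm
  · rw [cascade_one_add_cascade_two]
    exact (sum_Icc_eq_sum_fin hj hzero he (fun i x => (x + 1).choose (i + 1)) (by simp)).symm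

lemma isMacaulayUpper_cascade (c : MonoSeq t) :
    IsMacaulayUpper t (cascade 1 c) (cascade 1 c + cascade 2 c) := by
  by_cases hc : ∀ i, c i = 0
  · exact Or.inl (by simp [cascade, hc, Nat.choose_eq_zero_of_lt])
  obtain ⟨k, hk, hmin⟩ := exists_minimal_of_wellFoundedLT (fun k => c k ≠ 0) (not_forall.1 hc)
  have hzero (i : Fin t) (hi : (i : ℕ) + 1 < k + 1) : c i = 0 := by
    by_contra hne
    exact (hmin hne (Nat.le_of_lt (Nat.lt_of_succ_lt_succ hi))).not_gt (Nat.lt_of_succ_lt_succ hi)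
  let e : ℕ → ℕ := fun i => if h : i - 1 < t then c ⟨i - 1, h⟩ + (i - 1) else 0
  have he (i : Fin t) : e (i + 1) = c i + i := dif_pos i.is_lt
  have hj : 1 ≤ (k : ℕ) + 1 := Nat.le_add_left _ _
  refine Or.inr ⟨k + 1, e, ⟨hj, k.is_lt, ?_, ?_, ?_⟩, ?_⟩
  · rw [he]
    have := Nat.pos_of_ne_zero hk
    omega
  · intro i ⟨hki, hit⟩ i' ⟨_, hit'⟩ hii'
    obtain ⟨i, rfl⟩ : ∃ s, i = s + 1 := ⟨i - 1, by omega⟩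
    obtain ⟨i', rfl⟩ : ∃ s, i' = s + 1 := ⟨i' - 1, by omega⟩
    have hle : c ⟨i, hit⟩ ≤ c ⟨i', hit'⟩ := c.monotone (Fin.mk_le_mk.2 (by omega))
    calc e (i + 1) = c ⟨i, hit⟩ + i := he ⟨i, hit⟩
      _ < c ⟨i', hit'⟩ + i' := by omega
      _ = e (i' + 1) := (he ⟨i', hit'⟩).symm
  · exact (sum_Icc_eq_sum_fin hj hzero (fun i _ => he i) (fun i x => x.choose i) (by simp)).symm
  · rw [cascade_one_add_cascade_two]
    exact (sum_Icc_eq_sum_fin hj hzero (fun i _ => he i) (fun i x => (x + 1).choose (i + 1))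
      (by simp)).symm

lemma isMacaulayUpper_iff {a b : ℕ} : IsMacaulayUpper t a b ↔
    ∃ c : MonoSeq t, cascade 1 c = a ∧ cascade 1 c + cascade 2 c = b := by
  refine ⟨IsMacaulayUpper.exists_monoSeq, ?_⟩
  rintro ⟨c, rfl, rfl⟩
  exact isMacaulayUpper_cascade c

end MacaulayRep

section Conjugate

open scoped Finset

variable {d n t : ℕ}

namespace MonoSeq

/-- The conjugate, written as an increasing sequence, of the partition with the parts `s j ≤ t`. -/
def conjugate (t : ℕ) (s : MonoSeq d) : ℕ →o ℕ where
  toFun i := #{j | t ≤ s j + i}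
  monotone' _ _ h := Finset.card_le_card <| Finset.monotone_filter_right _ fun _ _ hj =>
    hj.trans (Nat.add_le_add_left h _)

lemma conjugate_apply (t : ℕ) (s : MonoSeq d) (i : ℕ) : conjugate t s i = #{j | t ≤ s j + i} :=
  rfl

lemma conjugate_mono (t : ℕ) : Monotone (conjugate t (d := d)) := fun s s' h i => by
  rw [conjugate_apply, conjugate_apply]
  exact Finset.card_le_card <| Finset.monotone_filter_right _ fun j _ hj =>
    hj.trans (Nat.add_le_add_right (h j) i)

lemma conjugate_le (t : ℕ) (s : MonoSeq d) (i : ℕ) : conjugate t s i ≤ d := by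
  rw [conjugate_apply]
  exact (Finset.card_le_univ _).trans_eq (Fintype.card_fin d)

lemma conjugate_self (t : ℕ) (s : MonoSeq d) : conjugate t s t = d := by
  simp [conjugate_apply]

lemma conjugate_tail_le (t : ℕ) (s : MonoSeq (d + 1)) : conjugate t s.tail ≤ conjugate t s :=
  fun i => by
    simp only [conjugate_apply, tail_apply]
    exact Finset.card_le_card_of_injOn Fin.succ
      (fun j hj => Finset.mem_filter.2 ⟨Finset.mem_univ _, (Finset.mem_filter.1 hj).2⟩)
      (Fin.succ_injective d).injOn

lemma le_conjugate_add_iff (s : MonoSeq d) (i : ℕ) (j : Fin d) :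
    d ≤ conjugate t s i + j ↔ t ≤ s j + i := by
  rw [conjugate_apply]
  constructor
  · intro h
    by_contra! hlt
    have hsub : #{j' | t ≤ s j' + i} ≤ #(Finset.Ioi j) := Finset.card_le_card fun j' hj' => by
      rw [Finset.mem_Ioi]
      by_contra! hle
      have := s.monotone hle
      have := (Finset.mem_filter.1 hj').2
      omega
    rw [Fin.card_Ioi] at hsub
    omega
  · intro h
    have hsub : #(Finset.Ici j) ≤ #{j' | t ≤ s j' + i} := Finset.card_le_card fun j' hj' => by
      have := s.monotone (Finset.mem_Ici.1 hj')
      exact Finset.mem_filter.2 ⟨Finset.mem_univ _, by omega⟩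
    rw [Fin.card_Ici] at hsub
    omega

lemma card_filter_le_add_val {a : ℕ} (h : a ≤ t) : #{i : Fin t | t ≤ a + i} = a := by
  have hcompl := Finset.card_filter_add_card_filter_not (s := Finset.univ)
    fun i : Fin t => (i : ℕ) < t - a
  have hlt : #{i : Fin t | (i : ℕ) < t - a} = t - a := by
    rw [Fin.card_filter_val_lt, min_eq_right (Nat.sub_le t a)]
  have hle : #{i : Fin t | ¬(i : ℕ) < t - a} = #{i : Fin t | t ≤ a + i} := by
    congr! 2 with i
    omega
  rw [hlt, hle, Finset.card_univ, Fintype.card_fin] at hcompl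
  omega

end MonoSeq

open MonoSeq

/-- The partition `r 0, …, r (d - 1)` with parts at most `r d` as the conjugate of the partition
given by `v`; the last entry `r d` is the length `k` of `v`. -/
def rows (d : ℕ) (k : Fin n) (v : MonoSeq k) : Fin (d + 1) →o Fin n where
  toFun j := ⟨conjugate d v j, (conjugate_le d v j).trans_lt k.is_lt⟩
  monotone' _ _ h := (conjugate d v).monotone h

/-- The conjugate of the partition `r 0, …, r (d - 1)` with parts at most `t`; the intended value of
`t` is the last entry `r d`. -/
def columns (t : ℕ) (r : Fin (d + 1) →o Fin n) : MonoSeq t :=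
  (conjugate t (init ((Fin.valOrderEmb n).toOrderHom.comp r))).comp (Fin.valOrderEmb t).toOrderHom

lemma rows_last (k : Fin n) (v : MonoSeq k) : rows d k v (Fin.last d) = k :=
  Fin.ext (conjugate_self d v)

lemma rows_mono (k : Fin n) : Monotone (rows d k) := fun _ _ h j => conjugate_mono d h j

lemma rows_tail_le (ht : t + 1 < n) (v : MonoSeq (t + 1)) :
    rows d ⟨t, (Nat.lt_succ_self t).trans ht⟩ v.tail ≤ rows d ⟨t + 1, ht⟩ v :=
  fun j => conjugate_tail_le d v j

lemma columns_apply_le (r : Fin (d + 1) →o Fin n) (i : Fin t) : columns t r i ≤ d :=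
  conjugate_le _ _ _

lemma columns_rows {k : Fin n} {v : MonoSeq k} (hv : ∀ i, v i ≤ d) :
    columns k (rows d k v) = v := by
  ext i
  change #{j : Fin d | (k : ℕ) ≤ conjugate d v j + i} = v i
  simp only [le_conjugate_add_iff]
  exact card_filter_le_add_val (hv i)

lemma rows_columns {k : Fin n} {r : Fin (d + 1) →o Fin n} (hr : r (Fin.last d) = k) :
    rows d k (columns k r) = r := by
  ext j
  induction j using Fin.lastCases with
  | last => rw [rows_last, hr]
  | cast j =>
    change #{i : Fin k | d ≤ columns k r i + j} = (r j.castSucc : ℕ)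
    have hiff (i : Fin k) : d ≤ columns k r i + j ↔ (k : ℕ) ≤ r j.castSucc + i :=
      le_conjugate_add_iff _ _ j
    simp only [hiff]
    exact card_filter_le_add_val (hr ▸ r.monotone (Fin.le_last _))

lemma columns_apply_le_columns_apply {t t' : ℕ} {r r' : Fin (d + 1) →o Fin n} (h : r' ≤ r)
    {i : Fin t'} {i' : Fin t} (hi : (i : ℕ) + t = i' + t') :
    columns t' r' i ≤ columns t r i' := by
  change #{j : Fin d | t' ≤ (r' j.castSucc : ℕ) + i} ≤ #{j : Fin d | t ≤ (r j.castSucc : ℕ) + i'}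
  refine Finset.card_le_card (Finset.monotone_filter_right _ fun j _ hj => ?_)
  have hr : (r' j.castSucc : ℕ) ≤ r j.castSucc := h j.castSucc
  omega

lemma ncard_last_eq {E : Set (Fin (d + 1) →o Fin n)} {k : Fin n} {A : Set (MonoSeq k)}
    (hA : ∀ v ∈ A, ∀ i, v i ≤ d)
    (hE : ∀ r : Fin (d + 1) →o Fin n, r (Fin.last d) = k → (r ∈ E ↔ columns k r ∈ A)) :
    {r | r ∈ E ∧ r (Fin.last d) = k}.ncard = A.ncard := by
  refine Set.ncard_congr (fun r _ => columns k r) (fun r hr => (hE r hr.2).1 hr.1)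
    (fun r r' hr hr' h => ?_) fun v hv => ⟨rows d k v, ⟨?_, rows_last k v⟩, columns_rows (hA v hv)⟩
  · rw [← rows_columns hr.2, h, rows_columns hr'.2]
  · rwa [hE _ (rows_last k v), columns_rows (hA v hv)]

end Conjugate

section MVector

open MonoSeq

variable {d n : ℕ} {ℓ : Fin n → ℕ} {E : Set (Fin (d + 1) →o Fin n)}

/-- The conjugates of the elements of `E` with last entry `k`. -/
def conjugateLayer (E : Set (Fin (d + 1) →o Fin n)) (k : Fin n) : Set (MonoSeq k) :=
  {v | (∀ i, v i ≤ d) ∧ rows d k v ∈ E}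

lemma conjugateLayer_finite (E : Set (Fin (d + 1) →o Fin n)) (k : Fin n) :
    (conjugateLayer E k).Finite :=
  haveI : Finite (Fin (d + 1) →o Fin n) := DFunLike.finite _
  Set.Finite.of_injOn (f := rows d k) (fun _ hv => hv.2)
    (fun v hv w hw h => by rw [← columns_rows hv.1, h, columns_rows hw.1]) E.toFinite

lemma ncard_conjugateLayer (E : Set (Fin (d + 1) →o Fin n)) (k : Fin n) :
    (conjugateLayer E k).ncard = {r | r ∈ E ∧ r (Fin.last d) = k}.ncard := by
  refine (ncard_last_eq (fun v hv => hv.1) fun r hr => ?_).symm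
  rw [conjugateLayer, Set.mem_ofPred_eq, rows_columns hr]
  exact (and_iff_right (columns_apply_le r)).symm

lemma isLowerSet_conjugateLayer (hE : IsLowerSet E) (k : Fin n) :
    IsLowerSet (conjugateLayer E k) :=
  fun _ _ h hv => ⟨fun i => (h i).trans (hv.1 i), hE (rows_mono k h) hv.2⟩

lemma tail_mem_conjugateLayer (hE : IsLowerSet E) {t : ℕ} (ht : t + 1 < n) {v : MonoSeq (t + 1)}
    (hv : v ∈ conjugateLayer E ⟨t + 1, ht⟩) :
    v.tail ∈ conjugateLayer E ⟨t, (Nat.lt_succ_self t).trans ht⟩ :=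
  ⟨fun i => hv.1 i.succ, hE (rows_tail_le ht v) hv.2⟩

lemma ncard_conjugateLayer_zero (hne : E.Nonempty) (hE : IsLowerSet E) (hn : 0 < n) :
    (conjugateLayer E ⟨0, hn⟩).ncard = 1 := by
  obtain ⟨r, hr⟩ := hne
  have hle : rows d ⟨0, hn⟩ ⊥ ≤ r := fun j =>
    ((rows d ⟨0, hn⟩ ⊥).monotone (Fin.le_last j)).trans ((rows_last _ _).trans_le (Nat.zero_le _))
  have hmem : (⊥ : MonoSeq 0) ∈ conjugateLayer E ⟨0, hn⟩ :=
    ⟨fun i => i.elim0, hE hle hr⟩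
  rw [Set.ncard_eq_one]
  exact ⟨⊥, Set.eq_singleton_iff_unique_mem.2
    ⟨hmem, fun v _ => DFunLike.ext v ⊥ fun i => i.elim0⟩⟩

lemma ncard_conjugateLayer_one_le (E : Set (Fin (d + 1) →o Fin n)) (hn : 1 < n) :
    (conjugateLayer E ⟨1, hn⟩).ncard ≤ d + 1 := by
  calc (conjugateLayer E ⟨1, hn⟩).ncard
      ≤ (Set.Iic d).ncard := Set.ncard_le_ncard_of_injOn (fun v : MonoSeq 1 => v 0)
        (fun v hv => hv.1 0) (fun v _ w _ h => DFunLike.ext v w fun i => by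
          rwa [Subsingleton.elim i 0]) (Set.finite_Iic d)
    _ = d + 1 := by rw [Set.ncard_Iic_nat]

lemma exists_isMacaulayUpper_ncard_conjugateLayer (hE : IsLowerSet E) {t : ℕ} (ht : 1 ≤ t)
    (htn : t + 1 < n) :
    ∃ b, IsMacaulayUpper t (conjugateLayer E ⟨t, (Nat.lt_succ_self t).trans htn⟩).ncard b ∧
      (conjugateLayer E ⟨t + 1, htn⟩).ncard ≤ b := by
  obtain ⟨t, rfl⟩ : ∃ s, t = s + 1 := ⟨t - 1, by omega⟩
  have hfin := conjugateLayer_finite E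
  obtain ⟨c, hc⟩ := exists_cascade_one_eq t (conjugateLayer E ⟨t + 1, by omega⟩).ncard
  refine ⟨_, isMacaulayUpper_iff.2 ⟨c, hc, rfl⟩, ?_⟩
  rw [Set.ncard_eq_toFinset_card _ (hfin _)] at hc ⊢
  refine card_le_cascade_add_cascade ?_ hc.ge fun v hv => ?_
  · rw [Set.Finite.coe_toFinset]
    exact isLowerSet_conjugateLayer hE _
  · rw [Set.Finite.mem_toFinset] at hv ⊢
    exact tail_mem_conjugateLayer hE htn hv

lemma isMVector_of_isLowerSet (hne : E.Nonempty) (hE : IsLowerSet E)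
    (hℓ : ∀ k, {r | r ∈ E ∧ r (Fin.last d) = k}.ncard = ℓ k) : IsMVector ℓ := by
  have hn : 0 < n := hne.elim fun r _ => (r 0).pos
  simp only [← ncard_conjugateLayer] at hℓ
  refine ⟨⟨hn, (hℓ _).symm.trans (ncard_conjugateLayer_zero hne hE hn)⟩, fun t ht htn => ?_⟩
  simp only [← hℓ]
  exact exists_isMacaulayUpper_ncard_conjugateLayer hE ht htn

lemma IsMVector.cascade_one_tail_lt (hM : IsMVector ℓ) {t : ℕ} (ht : t + 1 < n)
    {v : MonoSeq (t + 1)} (hv : cascade 1 v < ℓ ⟨t + 1, ht⟩) :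
    cascade 1 v.tail < ℓ ⟨t, (Nat.lt_succ_self t).trans ht⟩ := by
  obtain ⟨⟨_, h0⟩, hM⟩ := hM
  rcases Nat.eq_zero_or_pos t with rfl | htpos
  · simp [cascade_eq_zero, h0]
  obtain ⟨b, hb, hle⟩ := hM t htpos ht
  obtain ⟨c, hc, rfl⟩ := isMacaulayUpper_iff.1 hb
  by_contra! hlt
  rw [← hc] at hlt
  have hsum := cascade_tail_add_cascade_tail_le v
  have htwo := cascade_two_le_of_cascade_one_le hlt
  omega

lemma IsMVector.cascade_one_lt_of_le (hM : IsMVector ℓ) {t t' : ℕ} (htt' : t ≤ t') (ht' : t' < n)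
    {v : MonoSeq t'} {w : MonoSeq t}
    (hwv : ∀ (i : Fin t) (i' : Fin t'), (i : ℕ) + t' = i' + t → w i ≤ v i')
    (hv : cascade 1 v < ℓ ⟨t', ht'⟩) : cascade 1 w < ℓ ⟨t, htt'.trans_lt ht'⟩ := by
  induction t', htt' using Nat.le_induction with
  | base => exact (cascade_mono 1 fun i => hwv i i rfl).trans_lt hv
  | succ t' _ ih =>
    refine ih _ (v := v.tail) (fun i i' hi => hwv i i'.succ ?_) (hM.cascade_one_tail_lt ht' hv)
    rw [Fin.val_succ]
    omega

lemma IsMVector.apply_le (hM : IsMVector ℓ) (hℓ : ∀ h : 1 < n, ℓ ⟨1, h⟩ ≤ d + 1) {k : Fin n}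
    {v : MonoSeq k} (hv : cascade 1 v < ℓ k) (i : Fin k) : v i ≤ d := by
  have hk : 1 ≤ (k : ℕ) := Nat.one_le_iff_ne_zero.2 fun h => (i.cast h).elim0
  have hlt := hM.cascade_one_lt_of_le hk k.is_lt (w := OrderHom.const _ (v i))
    (fun i₁ i' hi' => v.monotone (Fin.le_def.2 (by omega))) hv
  rw [cascade_one_eq_apply_zero] at hlt
  have := hℓ (hk.trans_lt k.is_lt)
  exact Nat.lt_succ_iff.1 (hlt.trans_le this)

/-- The sequences whose columns are among the `ℓ k` first ones in the colexicographic order, where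
`k` is the last entry. -/
def colexInitial (d : ℕ) (ℓ : Fin n → ℕ) : Set (Fin (d + 1) →o Fin n) :=
  {r | cascade 1 (columns (r (Fin.last d)) r) < ℓ (r (Fin.last d))}

lemma IsMVector.isLowerSet_colexInitial (hM : IsMVector ℓ) : IsLowerSet (colexInitial d ℓ) :=
  fun r _ h hr => hM.cascade_one_lt_of_le (h (Fin.last d)) (r (Fin.last d)).is_lt
    (fun _ _ hi => columns_apply_le_columns_apply h hi) hr

lemma IsMVector.ncard_colexInitial (hM : IsMVector ℓ) (hℓ : ∀ h : 1 < n, ℓ ⟨1, h⟩ ≤ d + 1)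
    (k : Fin n) : {r | r ∈ colexInitial d ℓ ∧ r (Fin.last d) = k}.ncard = ℓ k := by
  rw [ncard_last_eq (A := {v | cascade 1 v < ℓ k}) (fun v hv => hM.apply_le hℓ hv) ?_]
  · refine ncard_setOf_cascade_one_lt fun hk => ?_
    obtain ⟨hn, h0⟩ := hM.1
    rwa [show k = ⟨0, hn⟩ from Fin.ext hk]
  · rintro r rfl
    rfl

lemma IsMVector.colexInitial_nonempty (hM : IsMVector ℓ)
    (hℓ : ∀ h : 1 < n, ℓ ⟨1, h⟩ ≤ d + 1) : (colexInitial d ℓ).Nonempty := by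
  obtain ⟨hn, h0⟩ := hM.1
  have hcard := (hM.ncard_colexInitial hℓ ⟨0, hn⟩).trans h0
  obtain ⟨r, hr⟩ := Set.nonempty_of_ncard_ne_zero (hcard.trans_ne one_ne_zero)
  exact ⟨r, hr.1⟩

theorem exists_isLowerSet_iff : (∃ E : Set (Fin (d + 1) →o Fin n), E.Nonempty ∧ IsLowerSet E ∧
      ∀ k, {r | r ∈ E ∧ r (Fin.last d) = k}.ncard = ℓ k) ↔
    IsMVector ℓ ∧ ∀ h2 : 1 < n, ℓ ⟨1, h2⟩ ≤ d + 1 := by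
  constructor
  · rintro ⟨E, hne, hE, hℓ⟩
    refine ⟨isMVector_of_isLowerSet hne hE hℓ, fun h2 => ?_⟩
    rw [← hℓ, ← ncard_conjugateLayer]
    exact ncard_conjugateLayer_one_le E h2
  · rintro ⟨hM, hℓ⟩
    exact ⟨colexInitial d ℓ, hM.colexInitial_nonempty hℓ, hM.isLowerSet_colexInitial,
      hM.ncard_colexInitial hℓ⟩

end MVector

section SeqMonomial

open scoped Finset

variable {m d : ℕ}

/-- The monomial `∏ i, x_{ρ i}`. -/
noncomputable def seqMonomial (ρ : Fin d → Fin m) : Fin m →₀ ℕ :=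
  ∑ i, Finsupp.single (ρ i) 1

lemma degree_seqMonomial (ρ : Fin d → Fin m) : (seqMonomial ρ).degree = d := by
  simp [seqMonomial, map_sum]

lemma toMultiset_seqMonomial (ρ : Fin d → Fin m) :
    Finsupp.toMultiset (seqMonomial ρ) = (List.ofFn ρ : Multiset (Fin m)) := by
  rw [← Fin.univ_val_map, seqMonomial, map_sum]
  simp only [Finsupp.toMultiset_single, one_smul]
  have := Multiset.sum_map_singleton (Multiset.map ρ Finset.univ.val)
  rwa [Multiset.map_map] at this

lemma mem_support_seqMonomial {ρ : Fin d → Fin m} {j : Fin m} :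
    j ∈ (seqMonomial ρ).support ↔ j ∈ Set.range ρ := by
  rw [← Finsupp.mem_toMultiset, toMultiset_seqMonomial, Multiset.mem_coe, List.mem_ofFn,
    Set.mem_range]

lemma isSquarefreeMonomial_seqMonomial {ρ : Fin d → Fin m} :
    IsSquarefreeMonomial (seqMonomial ρ) ↔ Function.Injective ρ := by
  classical
  rw [← List.nodup_ofFn, ← Multiset.coe_nodup, ← toMultiset_seqMonomial,
    Multiset.nodup_iff_count_le_one]
  simp only [Finsupp.count_toMultiset, IsSquarefreeMonomial]

lemma maxVar_seqMonomial (ρ : Fin (d + 1) →o Fin m) :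
    maxVar (seqMonomial ρ) = ρ (Fin.last d) + 1 := by
  refine le_antisymm (Finset.sup_le fun j hj => ?_)
    (Finset.le_sup (f := fun i : Fin m => (i : ℕ) + 1) (mem_support_seqMonomial.2 ⟨_, rfl⟩))
  obtain ⟨i, rfl⟩ := mem_support_seqMonomial.1 hj
  exact Nat.succ_le_succ (ρ.monotone (Fin.le_last i))

lemma exists_seqMonomial_eq {u : Fin m →₀ ℕ} (hu : u.degree = d) :
    ∃ ρ : Fin d →o Fin m, seqMonomial ρ = u := by
  have hlen : ((Finsupp.toMultiset u).sort (· ≤ ·)).length = d := by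
    rw [Multiset.length_sort, Finsupp.card_toMultiset]
    exact hu
  subst hlen
  refine ⟨⟨_, (Multiset.pairwise_sort (Finsupp.toMultiset u) (· ≤ ·)).sortedLE.monotone_get⟩, ?_⟩
  apply Multiset.toFinsupp.symm.injective
  change Finsupp.toMultiset (seqMonomial _) = Finsupp.toMultiset u
  rw [toMultiset_seqMonomial, OrderHom.coe_mk, List.ofFn_get, Multiset.sort_eq]

lemma exists_seqMonomial_eq_add_single {ρ ρ' : Fin d → Fin m} (k : Fin d)
    (h : ∀ i, i ≠ k → ρ i = ρ' i) :
    ∃ w, seqMonomial ρ = w + Finsupp.single (ρ k) 1 ∧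
      seqMonomial ρ' = w + Finsupp.single (ρ' k) 1 := by
  refine ⟨∑ i ∈ Finset.univ.erase k, Finsupp.single (ρ i) 1,
    (Finset.sum_erase_add _ _ (Finset.mem_univ k)).symm, ?_⟩
  rw [Finset.sum_congr rfl fun i hi => by rw [h i (Finset.ne_of_mem_erase hi)]]
  exact (Finset.sum_erase_add _ _ (Finset.mem_univ k)).symm

/-- The degree of the part of the monomial `x^u` in the variables from `q` on. -/
def tailDegree (q : Fin m) (u : Fin m →₀ ℕ) : ℕ := ∑ j ∈ Finset.Ici q, u j

lemma tailDegree_add (q : Fin m) (u v : Fin m →₀ ℕ) :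
    tailDegree q (u + v) = tailDegree q u + tailDegree q v := by
  simp [tailDegree, Finset.sum_add_distrib]

lemma tailDegree_single (q j : Fin m) :
    tailDegree q (Finsupp.single j 1) = if q ≤ j then 1 else 0 := by
  simp [tailDegree, Finsupp.single_apply]

lemma tailDegree_seqMonomial (q : Fin m) (ρ : Fin d → Fin m) :
    tailDegree q (seqMonomial ρ) = #{i | q ≤ ρ i} := by
  simp only [tailDegree, seqMonomial, Finsupp.finsetSum_apply]
  rw [Finset.sum_comm, Finset.card_filter]
  exact Finset.sum_congr rfl fun i _ => tailDegree_single q (ρ i)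

lemma le_of_tailDegree_le {ρ ρ' : Fin d →o Fin m}
    (h : ∀ q, tailDegree q (seqMonomial ρ) ≤ tailDegree q (seqMonomial ρ')) : ρ ≤ ρ' := by
  intro i
  by_contra! hlt
  have hle := h (ρ i)
  rw [tailDegree_seqMonomial, tailDegree_seqMonomial] at hle
  have hsub : #(Finset.Ici i) ≤ #{j | ρ i ≤ ρ j} := Finset.card_le_card fun j hj =>
    Finset.mem_filter.2 ⟨Finset.mem_univ _, ρ.monotone (Finset.mem_Ici.1 hj)⟩
  have hsup : #{j | ρ i ≤ ρ' j} ≤ #(Finset.Ioi i) := Finset.card_le_card fun j hj =>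
    Finset.mem_Ioi.2 (ρ'.monotone.reflect_lt (hlt.trans_le (Finset.mem_filter.1 hj).2))
  rw [Fin.card_Ici] at hsub
  rw [Fin.card_Ioi] at hsup
  omega

lemma seqMonomial_injective : Function.Injective fun ρ : Fin d →o Fin m => seqMonomial ρ :=
  fun _ _ h => le_antisymm (le_of_tailDegree_le fun q => (congrArg (tailDegree q) h).le)
    (le_of_tailDegree_le fun q => (congrArg (tailDegree q) h).ge)

lemma le_of_seqMonomial_eq_add_single {ρ ρ' : Fin d →o Fin m} {w : Fin m →₀ ℕ} {p q : Fin m}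
    (hpq : p ≤ q) (hρ : seqMonomial ρ = w + Finsupp.single p 1)
    (hρ' : seqMonomial ρ' = w + Finsupp.single q 1) : ρ ≤ ρ' := by
  refine le_of_tailDegree_le fun j => ?_
  simp only [hρ, hρ', tailDegree_add, tailDegree_single]
  gcongr
  split_ifs with hp hq
  · exact le_rfl
  · exact absurd (hp.trans hpq) hq
  all_goals exact Nat.zero_le _

end SeqMonomial

section Spread

variable {e m n d : ℕ}

lemma isLowerSet_of_forall_lower_entry {α : Type*} [Preorder α] {E : Set (Fin d →o α)}
    (h : ∀ r ∈ E, ∀ r' ≤ r, ∀ k, (∀ i, i ≠ k → r' i = r i) → r' ∈ E) : IsLowerSet E := by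
  intro r r' hle hr
  let hybrid (N : ℕ) : Fin d →o α :=
    { toFun i := if (i : ℕ) < N then r' i else r i
      monotone' i j hij := by
        have := Fin.le_def.1 hij
        dsimp only
        split_ifs
        · exact r'.monotone hij
        · exact (hle i).trans (r.monotone hij)
        · omega
        · exact r.monotone hij }
  have hybrid_apply (N : ℕ) (i : Fin d) : hybrid N i = if (i : ℕ) < N then r' i else r i := rfl
  have hmem (N : ℕ) (hN : N ≤ d) : hybrid N ∈ E := by
    induction N with
    | zero =>
      have hzero : hybrid 0 = r := by ext i; simp [hybrid_apply]
      rwa [hzero]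
    | succ N ih =>
      refine h _ (ih (Nat.le_of_succ_le hN)) _ (fun i => ?_) ⟨N, hN⟩ fun i hi => ?_
      · rw [hybrid_apply, hybrid_apply]
        split_ifs <;> first | omega | exact le_rfl | exact hle i
      · have hne : (i : ℕ) ≠ N := fun hiN => hi (Fin.ext hiN)
        have hiff : (i : ℕ) < N + 1 ↔ (i : ℕ) < N := by omega
        simp only [hybrid_apply, hiff]
  have hd : hybrid d = r' := by ext i; simp [hybrid_apply]
  exact hd ▸ hmem d le_rfl

/-- The sequence `r` with gaps of size `e` added between consecutive entries. -/
def spread (hm : n + e * d = m) (r : Fin (d + 1) →o Fin n) : Fin (d + 1) →o Fin m where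
  toFun i := ⟨r i + e * i, by
    have := Nat.mul_le_mul_left e (Fin.is_le i)
    omega⟩
  monotone' i j h := Nat.add_le_add (r.monotone h) (Nat.mul_le_mul_left e h)

lemma val_spread (hm : n + e * d = m) (r : Fin (d + 1) →o Fin n) (i : Fin (d + 1)) :
    (spread hm r i : ℕ) = r i + e * i := rfl

lemma spread_le_spread_iff (hm : n + e * d = m) {r r' : Fin (d + 1) →o Fin n} :
    spread hm r ≤ spread hm r' ↔ r ≤ r' :=
  forall_congr' fun _ => Nat.add_le_add_iff_right

lemma spread_castSucc_add_le (hm : n + e * d = m) (r : Fin (d + 1) →o Fin n) (i : Fin d) :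
    (spread hm r i.castSucc : ℕ) + e ≤ spread hm r i.succ := by
  have : (r i.castSucc : ℕ) ≤ r i.succ := r.monotone (Fin.castSucc_le_succ i)
  simp only [val_spread, Fin.val_castSucc, Fin.val_succ, Nat.mul_succ]
  omega

lemma exists_spread_eq (hm : n + e * d = m) {ρ : Fin (d + 1) →o Fin m}
    (h : ∀ i : Fin d, (ρ i.castSucc : ℕ) + e ≤ ρ i.succ) : ∃ r, spread hm r = ρ := by
  have hle (i : Fin (d + 1)) : e * i ≤ ρ i := by
    induction i using Fin.induction with
    | zero => simp
    | succ i ih =>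
      rw [Fin.val_succ, Nat.mul_succ]
      exact (Nat.add_le_add_right ih e).trans (h i)
  have hmono : Monotone fun i : Fin (d + 1) => (ρ i - e * i : ℕ) :=
    Fin.monotone_iff_le_succ.2 fun i => by
      have := h i
      simp only [Fin.val_castSucc, Fin.val_succ, Nat.mul_succ]
      omega
  have hlt (i : Fin (d + 1)) : (ρ i - e * i : ℕ) < n := by
    refine (hmono (Fin.le_last i)).trans_lt ?_
    have := hle (Fin.last d)
    have := (ρ (Fin.last d)).is_lt
    simp only [Fin.val_last] at *
    omega
  exact ⟨⟨fun i => ⟨ρ i - e * i, hlt i⟩, hmono⟩,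
    OrderHom.ext _ _ <| funext fun i => Fin.ext (Nat.sub_add_cancel (hle i))⟩

/-- The monomial `∏ i, x_{r i + e * i}`. The case `e = 0` yields all monomials of degree `d + 1`,
the case `e = 1` the squarefree ones. -/
noncomputable def spreadMonomial (hm : n + e * d = m) (r : Fin (d + 1) →o Fin n) : Fin m →₀ ℕ :=
  seqMonomial (spread hm r)

lemma spreadMonomial_injective (hm : n + e * d = m) : Function.Injective (spreadMonomial hm) :=
  fun r r' h => by
    have hspread := seqMonomial_injective h
    exact le_antisymm ((spread_le_spread_iff hm).1 hspread.le)
      ((spread_le_spread_iff hm).1 hspread.ge)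

lemma maxVar_spreadMonomial (hm : n + e * d = m) (r : Fin (d + 1) →o Fin n) :
    maxVar (spreadMonomial hm r) = r (Fin.last d) + e * d + 1 :=
  maxVar_seqMonomial _

lemma range_spreadMonomial_zero (hm : n + 0 * d = m) :
    Set.range (spreadMonomial hm) = {u | u.degree = d + 1} := by
  refine Set.Subset.antisymm (Set.range_subset_iff.2 fun r => degree_seqMonomial _) fun u hu => ?_
  obtain ⟨ρ, rfl⟩ := exists_seqMonomial_eq hu
  obtain ⟨r, rfl⟩ := exists_spread_eq hm (ρ := ρ) fun i => ρ.monotone (Fin.castSucc_le_succ i)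
  exact ⟨r, rfl⟩

lemma range_spreadMonomial_one (hm : n + 1 * d = m) :
    Set.range (spreadMonomial hm) = {u | u.degree = d + 1 ∧ IsSquarefreeMonomial u} := by
  refine Set.Subset.antisymm (Set.range_subset_iff.2 fun r => ⟨degree_seqMonomial _, ?_⟩)
    fun u hu => ?_
  · exact isSquarefreeMonomial_seqMonomial.2 (Fin.strictMono_iff_lt_succ.2
      (spread_castSucc_add_le hm r)).injective
  · obtain ⟨ρ, rfl⟩ := exists_seqMonomial_eq hu.1
    have hρ := ρ.monotone.strictMono_of_injective (isSquarefreeMonomial_seqMonomial.1 hu.2)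
    obtain ⟨r, rfl⟩ := exists_spread_eq hm (ρ := ρ) fun i => hρ Fin.castSucc_lt_succ
    exact ⟨r, rfl⟩

end Spread

section StableSets

variable {e m n d : ℕ} {V W : Set (Fin m →₀ ℕ)}

/-- The set `V` is strongly stable among the monomials in `W`. With `W` the monomials, respectively
the squarefree monomials, of a fixed degree this covers both notions of stability. -/
def IsStronglyStableIn (W V : Set (Fin m →₀ ℕ)) : Prop :=
  ∀ (w : Fin m →₀ ℕ) (p q : Fin m), p < q →
    w + Finsupp.single q 1 ∈ V → w + Finsupp.single p 1 ∈ W → w + Finsupp.single p 1 ∈ V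

lemma degree_add_single_eq {σ : Type*} (w : σ →₀ ℕ) (p q : σ) :
    (w + Finsupp.single p 1).degree = (w + Finsupp.single q 1).degree := by
  simp only [map_add, Finsupp.degree_single]

lemma exists_eq_add_single_of_mem_support {σ : Type*} {u : σ →₀ ℕ} {q : σ}
    (hq : q ∈ u.support) : ∃ w, u = w + Finsupp.single q 1 :=
  ⟨_, (tsub_add_cancel_of_le <| Finsupp.single_le_iff.2 <|
    Nat.one_le_iff_ne_zero.2 <| Finsupp.mem_support_iff.1 hq).symm⟩

lemma isStronglyStableSet_iff (hV : V ⊆ {u | u.degree = d}) :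
    IsStronglyStableSet V ↔ IsStronglyStableIn {u | u.degree = d} V :=
  ⟨fun h w p q hpq hw _ => h w p q hpq hw, fun h w p q hpq hw =>
    h w p q hpq hw ((degree_add_single_eq w p q).trans (hV hw))⟩

lemma IsSquarefreeMonomial.apply_eq_zero {w : Fin m →₀ ℕ} {p : Fin m}
    (h : IsSquarefreeMonomial (w + Finsupp.single p 1)) : w p = 0 := by
  have := h p
  rw [Finsupp.add_apply, Finsupp.single_eq_same] at this
  omega

lemma IsSquarefreeMonomial.anti {v w : Fin m →₀ ℕ} (h : IsSquarefreeMonomial w) (hvw : v ≤ w) :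
    IsSquarefreeMonomial v := fun i => (hvw i).trans (h i)

lemma IsSquarefreeMonomial.add_single {w : Fin m →₀ ℕ} {p : Fin m}
    (h : IsSquarefreeMonomial w) (hp : w p = 0) :
    IsSquarefreeMonomial (w + Finsupp.single p 1) := fun i => by
  rcases eq_or_ne i p with rfl | hi
  · simp [hp]
  · simpa [Finsupp.single_eq_of_ne hi] using h i

lemma isSquarefreeStronglyStableSet_iff
    (hV : V ⊆ {u | u.degree = d ∧ IsSquarefreeMonomial u}) :
    IsSquarefreeStronglyStableSet V ↔
      IsStronglyStableIn {u | u.degree = d ∧ IsSquarefreeMonomial u} V := by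
  constructor
  · intro h w p q hpq hq hp
    have hwp := hp.2.apply_eq_zero
    have := h _ hq p q hpq (by simp [hwp, hpq.ne]) (by simp)
    rwa [add_tsub_cancel_right] at this
  · intro h u hu p q hpq hp hq
    obtain ⟨w, rfl⟩ := exists_eq_add_single_of_mem_support hq
    have hw : IsSquarefreeMonomial w := (hV hu).2.anti le_self_add
    have hwp : w p = 0 := by simp_all
    rw [add_tsub_cancel_right]
    exact h w p q hpq hu ⟨(degree_add_single_eq w p q).trans (hV hu).1, hw.add_single hwp⟩

lemma isStronglyStableIn_iff_isLowerSet (hm : n + e * d = m)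
    (hV : V ⊆ Set.range (spreadMonomial hm)) :
    IsStronglyStableIn (Set.range (spreadMonomial hm)) V ↔
      IsLowerSet (spreadMonomial hm ⁻¹' V) := by
  constructor
  · intro h
    refine isLowerSet_of_forall_lower_entry fun r hr r' hle k hk => ?_
    obtain ⟨w, hw', hw⟩ := exists_seqMonomial_eq_add_single (ρ := spread hm r')
      (ρ' := spread hm r) k fun i hi => Fin.ext (by rw [val_spread, val_spread, hk i hi])
    rw [Set.mem_preimage, spreadMonomial] at hr ⊢
    rcases ((spread_le_spread_iff hm).2 hle k).eq_or_lt with heq | hlt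
    · rwa [hw', heq, ← hw]
    · rw [hw']
      exact h w _ _ hlt (hw ▸ hr) ⟨r', hw'⟩
  · rintro h w p q hpq hq ⟨r', hr'⟩
    obtain ⟨r, hr⟩ := hV hq
    rw [← hr']
    refine h ((spread_le_spread_iff hm).1 ?_) (hr ▸ hq : spreadMonomial hm r ∈ V)
    exact le_of_seqMonomial_eq_add_single hpq.le hr' hr

lemma ncard_maxVar_eq (hm : n + e * d = m) (hV : V ⊆ Set.range (spreadMonomial hm)) (k : Fin n) :
    {u | u ∈ V ∧ maxVar u = k + e * d + 1}.ncard =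
      {r | r ∈ spreadMonomial hm ⁻¹' V ∧ r (Fin.last d) = k}.ncard := by
  rw [← Set.ncard_preimage_of_injective_subset_range (spreadMonomial_injective hm)
    fun u hu => hV hu.1]
  refine congrArg Set.ncard (Set.ext fun r => and_congr_right fun _ => ?_)
  rw [maxVar_spreadMonomial, Fin.ext_iff]
  omega

theorem exists_isStronglyStableIn_iff (hm : n + e * d = m) (ℓ : Fin n → ℕ) :
    (∃ V ⊆ Set.range (spreadMonomial hm), V.Nonempty ∧
      IsStronglyStableIn (Set.range (spreadMonomial hm)) V ∧
      ∀ k : Fin n, {u | u ∈ V ∧ maxVar u = k + e * d + 1}.ncard = ℓ k) ↔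
    IsMVector ℓ ∧ ∀ h2 : 1 < n, ℓ ⟨1, h2⟩ ≤ d + 1 := by
  rw [← exists_isLowerSet_iff]
  constructor
  · rintro ⟨V, hV, hne, hst, hℓ⟩
    exact ⟨spreadMonomial hm ⁻¹' V, hne.preimage' hV,
      (isStronglyStableIn_iff_isLowerSet hm hV).1 hst,
      fun k => (ncard_maxVar_eq hm hV k).symm.trans (hℓ k)⟩
  · rintro ⟨E, hne, hE, hℓ⟩
    have hV := Set.image_subset_range (spreadMonomial hm) E
    have hpre := Set.preimage_image_eq E (spreadMonomial_injective hm)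
    refine ⟨_, hV, hne.image _, ?_, fun k => ?_⟩
    · rwa [isStronglyStableIn_iff_isLowerSet hm hV, hpre]
    · rw [ncard_maxVar_eq hm hV, hpre, hℓ]

end StableSets

section Ideals

variable {K : Type*} [Field K] {m d : ℕ} {V : Set (Fin m →₀ ℕ)} {u : Fin m →₀ ℕ}

variable (K) in
/-- The monomial ideal generated by the monomials in `V`. -/
noncomputable abbrev monomialSpan (V : Set (Fin m →₀ ℕ)) : Ideal (MvPolynomial (Fin m) K) :=
  Ideal.span ((fun u => monomial u (1 : K)) '' V)

lemma mem_monomialsIn_monomialSpan :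
    u ∈ monomialsIn (monomialSpan K V) ↔ ∃ v ∈ V, v ≤ u := by
  classical
  change monomial u (1 : K) ∈ monomialSpan K V ↔ _
  rw [mem_ideal_span_monomial_image, support_monomial, if_neg one_ne_zero]
  simp

lemma subset_monomialsIn_monomialSpan : V ⊆ monomialsIn (monomialSpan K V) :=
  fun u hu => mem_monomialsIn_monomialSpan.2 ⟨u, hu, le_rfl⟩

lemma monomialSpan_ne_bot : monomialSpan K V ≠ ⊥ ↔ V.Nonempty := by
  simp [Set.Nonempty]

lemma eq_of_le_of_degree_eq {σ : Type*} {u v : σ →₀ ℕ} (h : v ≤ u) (hd : v.degree = u.degree) :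
    v = u := by
  rw [← tsub_add_cancel_of_le h, map_add, right_eq_add, Finsupp.degree_eq_zero_iff] at hd
  exact h.antisymm (tsub_eq_zero_iff_le.1 hd)

lemma mem_monomialsIn_monomialSpan_iff_mem (hV : V ⊆ {u | u.degree = d}) (hu : u.degree = d) :
    u ∈ monomialsIn (monomialSpan K V) ↔ u ∈ V := by
  refine ⟨fun h => ?_, fun h => subset_monomialsIn_monomialSpan h⟩
  obtain ⟨v, hv, hvu⟩ := mem_monomialsIn_monomialSpan.1 h
  rwa [← eq_of_le_of_degree_eq hvu ((hV hv).trans hu.symm)]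

lemma minGens_monomialSpan (hV : V ⊆ {u | u.degree = d}) : minGens (monomialSpan K V) = V := by
  ext u
  constructor
  · rintro ⟨hu, hmin⟩
    obtain ⟨v, hv, hvu⟩ := mem_monomialsIn_monomialSpan.1 hu
    rwa [← hvu.antisymm (hmin (subset_monomialsIn_monomialSpan hv) hvu)]
  · refine fun hu => ⟨subset_monomialsIn_monomialSpan hu, fun w hw hwu => ?_⟩
    obtain ⟨v, hv, hvw⟩ := mem_monomialsIn_monomialSpan.1 hw
    rwa [← eq_of_le_of_degree_eq (hvw.trans hwu) ((hV hv).trans (hV hu).symm)]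

lemma IsMonomialIdeal.mem_monomialsIn_of_mem_support {I : Ideal (MvPolynomial (Fin m) K)}
    (hI : IsMonomialIdeal I) {f : MvPolynomial (Fin m) K} (hf : f ∈ I) (hu : u ∈ f.support) :
    u ∈ monomialsIn I := by
  obtain ⟨V, rfl⟩ := hI
  exact mem_monomialsIn_monomialSpan.2 (mem_ideal_span_monomial_image.1 hf u hu)

lemma isMonomialIdeal_and_isGeneratedInDegree_iff {I : Ideal (MvPolynomial (Fin m) K)} :
    IsMonomialIdeal I ∧ IsGeneratedInDegree I d ↔
      ∃ V ⊆ {u | u.degree = d}, I = monomialSpan K V := by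
  constructor
  · rintro ⟨hI, F, hF, hIF⟩
    refine ⟨{u | u ∈ monomialsIn I ∧ u.degree = d}, fun u hu => hu.2, le_antisymm ?_ ?_⟩
    · rw [hIF, Ideal.span_le, ← hIF]
      intro f hf
      refine mem_ideal_span_monomial_image.2 fun u hu => ⟨u, ⟨?_, ?_⟩, le_rfl⟩
      · exact hI.mem_monomialsIn_of_mem_support (hIF ▸ Ideal.subset_span hf) hu
      · by_contra hne
        exact mem_support_iff.1 hu ((hF f hf).coeff_eq_zero hne)
    · rw [Ideal.span_le, Set.image_subset_iff]
      exact fun u hu => hu.1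
  · rintro ⟨V, hV, rfl⟩
    refine ⟨⟨V, rfl⟩, _, ?_, rfl⟩
    rw [Set.forall_mem_image]
    exact fun u hu => isHomogeneous_monomial _ (hV hu)

lemma le_of_le_add_single {σ : Type*} {u v : σ →₀ ℕ} {q : σ} (h : v ≤ u + Finsupp.single q 1)
    (hq : v q = 0) : v ≤ u := fun i => by
  rcases eq_or_ne i q with rfl | hi
  · exact hq.trans_le (Nat.zero_le _)
  · simpa [Finsupp.single_eq_of_ne hi] using h i

lemma isStronglyStable_monomialSpan_iff (hV : V ⊆ {u | u.degree = d}) :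
    IsStronglyStable (monomialSpan K V) ↔ IsStronglyStableSet V := by
  constructor
  · rintro ⟨-, hst⟩ w p q hpq hq
    rw [← mem_monomialsIn_monomialSpan_iff_mem (K := K) hV
      ((degree_add_single_eq w p q).trans (hV hq))]
    exact hst w p q hpq (subset_monomialsIn_monomialSpan hq)
  · refine fun hst => ⟨⟨V, rfl⟩, fun u p q hpq hu => mem_monomialsIn_monomialSpan.2 ?_⟩
    obtain ⟨v, hv, hvu⟩ := mem_monomialsIn_monomialSpan.1 hu
    by_cases hq : q ∈ v.support
    · obtain ⟨w, rfl⟩ := exists_eq_add_single_of_mem_support hq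
      exact ⟨_, hst w p q hpq hv, by simpa using hvu⟩
    · exact ⟨v, hv, le_add_right (le_of_le_add_single hvu (Finsupp.notMem_support_iff.1 hq))⟩

lemma IsSquarefreeMonomialIdeal.isSquarefreeMonomial_of_mem (hV : V ⊆ {u | u.degree = d})
    (h : IsSquarefreeMonomialIdeal (monomialSpan K V)) (hu : u ∈ V) : IsSquarefreeMonomial u := by
  obtain ⟨V', hsq, hspan⟩ := h
  obtain ⟨v', hv', hvu⟩ : ∃ v' ∈ V', v' ≤ u := by
    rw [← mem_monomialsIn_monomialSpan (K := K), monomialSpan, ← hspan]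
    exact subset_monomialsIn_monomialSpan hu
  obtain ⟨v, hv, hvv⟩ : ∃ v ∈ V, v ≤ v' := by
    rw [← mem_monomialsIn_monomialSpan (K := K), hspan]
    exact subset_monomialsIn_monomialSpan hv'
  have hvu' : v = u := eq_of_le_of_degree_eq (hvv.trans hvu) ((hV hv).trans (hV hu).symm)
  exact (hsq v' hv').anti (hvu' ▸ hvv)

lemma IsSquarefreeStronglyStableSet.isSquarefreeStronglyStable_monomialSpan
    (hst : IsSquarefreeStronglyStableSet V) (hsq : V ⊆ {u | IsSquarefreeMonomial u}) :
    IsSquarefreeStronglyStable (monomialSpan K V) := by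
  refine ⟨⟨V, hsq, rfl⟩, ?_⟩
  rintro u ⟨hu, husq⟩ p q hpq hp hq
  obtain ⟨v, hv, hvu⟩ := mem_monomialsIn_monomialSpan.1 hu
  have hpv : p ∉ v.support := fun h => hp (Finsupp.support_mono hvu h)
  obtain ⟨w, rfl⟩ := exists_eq_add_single_of_mem_support hq
  have hwp : w p = 0 := by simp_all
  rw [add_tsub_cancel_right]
  refine ⟨mem_monomialsIn_monomialSpan.2 ?_, (husq.anti le_self_add).add_single hwp⟩
  by_cases hqv : q ∈ v.support
  · refine ⟨_, hst v hv p q hpq hpv hqv, ?_⟩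
    gcongr
    exact tsub_le_iff_right.2 hvu
  · exact ⟨v, hv, le_add_right (le_of_le_add_single hvu (Finsupp.notMem_support_iff.1 hqv))⟩

lemma isSquarefreeStronglyStable_monomialSpan_iff (hV : V ⊆ {u | u.degree = d}) :
    IsSquarefreeStronglyStable (monomialSpan K V) ↔
      V ⊆ {u | IsSquarefreeMonomial u} ∧ IsSquarefreeStronglyStableSet V := by
  refine ⟨fun ⟨hI, hst⟩ => ?_, fun ⟨hsq, hst⟩ => hst.isSquarefreeStronglyStable_monomialSpan hsq⟩
  have hsq (u) (hu : u ∈ V) : IsSquarefreeMonomial u := hI.isSquarefreeMonomial_of_mem hV hu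
  refine ⟨hsq, fun u hu p q hpq hp hq => ?_⟩
  have hmem := (hst u ⟨subset_monomialsIn_monomialSpan hu, hsq u hu⟩ p q hpq hp hq).1
  obtain ⟨w, rfl⟩ := exists_eq_add_single_of_mem_support hq
  rw [add_tsub_cancel_right] at hmem ⊢
  rwa [← mem_monomialsIn_monomialSpan_iff_mem (K := K) hV
    ((degree_add_single_eq w p q).trans (hV hu))]

theorem exists_isStronglyStable_iff {n : ℕ} (ℓ : Fin n → ℕ) :
    (∃ I : Ideal (MvPolynomial (Fin n) K),
      I ≠ ⊥ ∧ IsStronglyStable I ∧ IsGeneratedInDegree I (d + 1) ∧ ellSeq I = ℓ) ↔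
    IsMVector ℓ ∧ ∀ h2 : 1 < n, ℓ ⟨1, h2⟩ ≤ d + 1 := by
  have hm : n + 0 * d = n := by rw [Nat.zero_mul, Nat.add_zero]
  rw [← exists_isStronglyStableIn_iff hm ℓ, range_spreadMonomial_zero hm]
  simp only [Nat.zero_mul, Nat.add_zero]
  constructor
  · rintro ⟨I, hne, hst, hd, rfl⟩
    obtain ⟨V, hV, rfl⟩ := isMonomialIdeal_and_isGeneratedInDegree_iff.1 ⟨hst.1, hd⟩
    refine ⟨V, hV, monomialSpan_ne_bot.1 hne, (isStronglyStableSet_iff hV).1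
      ((isStronglyStable_monomialSpan_iff hV).1 hst), fun k => ?_⟩
    rw [ellSeq, minGens_monomialSpan hV]
  · rintro ⟨V, hV, hne, hst, hℓ⟩
    refine ⟨monomialSpan K V, monomialSpan_ne_bot.2 hne, (isStronglyStable_monomialSpan_iff hV).2
      ((isStronglyStableSet_iff hV).2 hst),
      (isMonomialIdeal_and_isGeneratedInDegree_iff.2 ⟨V, hV, rfl⟩).2, funext fun k => ?_⟩
    rw [ellSeq, minGens_monomialSpan hV, hℓ]

lemma ellStarSeq_monomialSpan {n : ℕ} {V : Set (Fin (n + (d + 1) - 1) →₀ ℕ)}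
    (hV : V ⊆ {u | u.degree = d + 1}) (k : Fin n) :
    ellStarSeq n (d + 1) (monomialSpan K V) k =
      {u | u ∈ V ∧ maxVar u = k + 1 * d + 1}.ncard := by
  rw [ellStarSeq, minGens_monomialSpan hV, show (k : ℕ) + 1 + (d + 1) - 1 = k + 1 * d + 1 by omega]

theorem exists_isSquarefreeStronglyStable_iff {n : ℕ} (ℓ : Fin n → ℕ) :
    (∃ I : Ideal (MvPolynomial (Fin (n + (d + 1) - 1)) K),
      I ≠ ⊥ ∧ IsSquarefreeStronglyStable I ∧ IsGeneratedInDegree I (d + 1) ∧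
        ellStarSeq n (d + 1) I = ℓ) ↔
    IsMVector ℓ ∧ ∀ h2 : 1 < n, ℓ ⟨1, h2⟩ ≤ d + 1 := by
  have hm : n + 1 * d = n + (d + 1) - 1 := by rw [Nat.one_mul, Nat.add_succ_sub_one]
  rw [← exists_isStronglyStableIn_iff hm ℓ, range_spreadMonomial_one hm]
  constructor
  · rintro ⟨I, hne, hst, hd, rfl⟩
    obtain ⟨W, -, hW⟩ := hst.1
    obtain ⟨V, hV, rfl⟩ := isMonomialIdeal_and_isGeneratedInDegree_iff.1 ⟨⟨W, hW⟩, hd⟩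
    obtain ⟨hVsq, hVst⟩ := (isSquarefreeStronglyStable_monomialSpan_iff hV).1 hst
    have hV' := Set.subset_inter hV hVsq
    exact ⟨V, hV', monomialSpan_ne_bot.1 hne, (isSquarefreeStronglyStableSet_iff hV').1 hVst,
      fun k => (ellStarSeq_monomialSpan hV k).symm⟩
  · rintro ⟨V, hV', hne, hst, hℓ⟩
    have hV : V ⊆ {u | u.degree = d + 1} := fun u hu => (hV' hu).1
    exact ⟨monomialSpan K V, monomialSpan_ne_bot.2 hne,
      (isSquarefreeStronglyStable_monomialSpan_iff hV).2
        ⟨fun u hu => (hV' hu).2, (isSquarefreeStronglyStableSet_iff hV').2 hst⟩,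
      (isMonomialIdeal_and_isGeneratedInDegree_iff.2 ⟨V, hV, rfl⟩).2,
      funext fun k => (ellStarSeq_monomialSpan hV k).trans (hℓ k)⟩

end Ideals

end MonomialIdeals

open MonomialIdeals in
theorem mainTheorem12 {K : Type*} [Field K] (n d : ℕ) (hd : 0 < d) (ℓ : Fin n → ℕ) :
    List.TFAE [
      ∃ I : Ideal (MvPolynomial (Fin n) K),
        I ≠ ⊥ ∧ IsStronglyStable I ∧ IsGeneratedInDegree I d ∧ ellSeq I = ℓ,
      ∃ I : Ideal (MvPolynomial (Fin (n + d - 1)) K),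
        I ≠ ⊥ ∧ IsSquarefreeStronglyStable I ∧ IsGeneratedInDegree I d ∧ ellStarSeq n d I = ℓ,
      IsMVector ℓ ∧ ∀ h2 : 1 < n, ℓ ⟨1, h2⟩ ≤ d] := by
  obtain ⟨e, rfl⟩ : ∃ e, d = e + 1 := ⟨d - 1, by omega⟩
  rw [exists_isStronglyStable_iff, exists_isSquarefreeStronglyStable_iff]
  tfae_finish
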